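/- **Notation.** $\mathbb N=\{0,1,2,\dots\}$. Let $A\in\mathbb Z^{m\times d}$ with $\ker_{\mathbb Z}(A)\cap\mathbb N^d=\{0\}$. Let $\mathbb NA\subseteq\mathbb Z^m$ be the affine semigroup generated by the columns of $A$. For $b\in\mathbb Z^m$ let $\mathcal F_{A,b}=\{u\in\mathbb N^d: Au=b\}$, which is a finite set, and let $\mathcal R_{A,b}=\{x\in\mathbb Q_{\ge0}^d: Ax=b\}$, whose dimension is that of its affine hull. For finite sets $\mathcal F,\mathcal M\subset\mathbb Z^d$ put $\pm\mathcal M=\mathcal M\cup(-\mathcal M)$. The *fiber graph* $\mathcal F(\mathcal M)$ is the undirected graph with node set $\mathcal F$ in which $u,v\in\mathcal F$ are adjacent if $u-v\in\pm\mathcal M$ (so every node has a loop if $0\in\mathcal M$), and in which every node $w$ gets in addition one loop for each $m\in\pm\mathcal M$ with $w+m\notin\mathcal F$. Write $\mathcal F_{A,b}(\mathcal M)$ for the fiber graph on $\mathcal F_{A,b}$. A finite set $\mathcal M\subset\ker_{\mathbb Z}(A)$ is a *Markov basis* for $A$ if $\mathcal F_{A,b}(\mathcal M)$ is connected for every $b\in\mathbb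 NA$. The *simple walk* on a graph $G$ moves from $v$ to $w$ with probability (number of edges between $v$ and $w$)/(number of edges incident to $v$), where each loop counts once. Let $\lambda(G)$ be the second largest eigenvalue modulus of its transition matrix, that is, the second entry in the decreasing list of the moduli of the eigenvalues, counted with multiplicity ($\lambda(G)=0$ if $G$ has only one node). A sequence $(G_i)_{i\in\mathbb N}$ of finite graphs with node sets $V_i$ is an *expander* if there is $\epsilon>0$ with $\lambda(G_i)\le 1-\epsilon$ for all $i\in\mathbb N$. It is *rapidly mixing* if there is a polynomial $p$ with nonnegative rational coefficients such that, for all $i\in\mathbb N$, $p(\log|V_i|)>0$ and $\lambda(G_i)\le 1-\frac1{p(\log|V_i|)}$. A sequence $(b_i)_{i\in\mathbb N}$ in $\mathbb NA$ is *dominated* if there is $b\in\mathbb NA$ with $\dim\mathcal R_{A,b}>0$ such that $b_i-i\cdot b\in\mathbb NA$ for all $i\in\mathbb N$, and there are $u\in\mathcal F_{A,b}$ and $w_i\in\mathcal F_{A,b_i-i\cdot b}$ with $\operatorname{supp}(w_i)\subseteq\operatorname{supp}(u)$ for all $i\in\mathbb N$. It has a *meaningful parametrization* if there is a polynomial $q\in\mathbb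 Q[t]$ with $|\mathcal F_{A,b_i}|\le q(i)$ for all $i\in\mathbb N$. **Theorem.** Let $A\in\mathbb Z^{m\times d}$ with $\ker_{\mathbb Z}(A)\cap\mathbb N^d=\{0\}$, let $\mathcal M\subset\ker_{\mathbb Z}(A)$ be a Markov basis for $A$, and let $(b_i)_{i\in\mathbb N}$ be a dominated sequence in $\mathbb NA$. Then $(\mathcal F_{A,b_i}(\mathcal M))_{i\in\mathbb N}$ is not an expander. If additionally $(b_i)_{i\in\mathbb N}$ has a meaningful parametrization, then $(\mathcal F_{A,b_i}(\mathcal M))_{i\in\mathbb N}$ is not rapidly mixing. -/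

import Mathlib

noncomputable section

open scoped Pointwise

namespace FiberWalk

/-! ## Undirected graphs with multiple edges and loops, and their simple walks -/

/-- An undirected graph on `V` in which multiple edges and multiple loops are allowed, given by the
number `adj u v` of edges with endpoints `u` and `v` (the number of loops at `u` if `u = v`). -/
structure Multigraph (V : Type*) where
  adj : V → V → ℕ
  symm : ∀ u v, adj u v = adj v u

namespace Multigraph

variable {V : Type*}

/-- A graph is connected if it has a node and any two nodes are joined by a path. -/
def Connected (G : Multigraph V) : Prop :=
  Nonempty V ∧ ∀ u v : V, Relation.ReflTransGen (fun x y => 0 < G.adj x y) u v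

/-- The number of edges incident to `v`; every loop counts once. -/
def degree [Fintype V] (G : Multigraph V) (v : V) : ℕ := ∑ w, G.adj v w

/-- The transition matrix of the simple walk: from `u`, choose an incident edge uniformly. -/
def walkMatrix [Fintype V] (G : Multigraph V) : Matrix V V ℝ :=
  Matrix.of fun u v => (G.adj u v : ℝ) / (G.degree u : ℝ)

end Multigraph

/-- The second largest eigenvalue modulus of a square matrix: list the moduli of all complex
eigenvalues, repeated according to (algebraic) multiplicity, in decreasing order, and take the
second entry.  If there are fewer than two eigenvalues, it is `0`. -/
def slem {V : Type*} [Fintype V] [DecidableEq V] (S : Matrix V V ℝ) : ℝ :=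
  (((S.map (algebraMap ℝ ℂ)).charpoly.roots.map fun z => ‖z‖).sort (· ≥ ·)).getD 1 0

/-- The sequence of graphs `G i` is an expander. -/
def IsExpander {V : ℕ → Type*} [∀ i, Fintype (V i)] [∀ i, DecidableEq (V i)]
    (G : ∀ i, Multigraph (V i)) : Prop :=
  ∃ ε : ℝ, 0 < ε ∧ ∀ i, slem (G i).walkMatrix ≤ 1 - ε

/-- The sequence of graphs `G i` is rapidly mixing: for some polynomial `p` with nonnegative
rational coefficients, `λ_i ≤ 1 - 1 / p (log |V_i|)` for all `i`.  The quotient has to make sense,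
so `p (log |V_i|)` is required to be nonzero, that is, positive. -/
def IsRapidlyMixing {V : ℕ → Type*} [∀ i, Fintype (V i)] [∀ i, DecidableEq (V i)]
    (G : ∀ i, Multigraph (V i)) : Prop :=
  ∃ p : Polynomial ℚ, (∀ k, 0 ≤ p.coeff k) ∧
    ∀ i, 0 < Polynomial.aeval (Real.log (Fintype.card (V i))) p ∧
      slem (G i).walkMatrix ≤ 1 - 1 / Polynomial.aeval (Real.log (Fintype.card (V i))) p

/-! ## Fibers and fiber graphs -/

/-- The fiber graph `F(M)` on `F`: distinct `u, v` are adjacent if `u - v ∈ ±M`; every node `u`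
gets a loop for every `m ∈ ±M` with `u + m ∉ F` (and one for `m = 0` if `0 ∈ M`). -/
def fiberGraph {d : ℕ} (F M : Finset (Fin d → ℤ)) : Multigraph F where
  adj u v := (if (u : Fin d → ℤ) - v ∈ M ∪ -M then 1 else 0) +
    (if u = v then ((M ∪ -M).filter fun m => (u : Fin d → ℤ) + m ∉ F).card else 0)
  symm u v := by
    have h : ((u : Fin d → ℤ) - v ∈ M ∪ -M) ↔ ((v : Fin d → ℤ) - u ∈ M ∪ -M) := by
      simp only [Finset.mem_union, Finset.mem_neg', neg_sub]
      exact or_comm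
    by_cases huv : u = v
    · subst huv; rfl
    · simp only [h, huv, Ne.symm huv, if_false]

/-- The standing assumption on a fiber-defining matrix: `ker_ℤ(A) ∩ ℕ^d = {0}`. -/
def IsFiberDefining {m d : ℕ} (A : Matrix (Fin m) (Fin d) ℤ) : Prop :=
  ∀ x : Fin d → ℤ, 0 ≤ x → A.mulVec x = 0 → x = 0

/-- The affine semigroup `ℕA` generated by the columns of `A`. -/
def affineSemigroup {m d : ℕ} (A : Matrix (Fin m) (Fin d) ℤ) : AddSubmonoid (Fin m → ℤ) :=
  AddSubmonoid.closure (Set.range A.col)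

theorem fiber_finite {m d : ℕ} {A : Matrix (Fin m) (Fin d) ℤ} (hA : IsFiberDefining A)
    (b : Fin m → ℤ) : {u : Fin d → ℤ | 0 ≤ u ∧ A.mulVec u = b}.Finite := by
  have hN : {n : Fin d → ℕ | A.mulVec (fun j => (n j : ℤ)) = b}.Finite := by
    refine WellQuasiOrderedLE.finite_of_isAntichain fun x hx y hy hne hle => hne ?_
    have h0 := hA (fun j => (y j : ℤ) - x j) (fun j => sub_nonneg.2 (Int.ofNat_le.2 (hle j))) (by
      have : (fun j => (y j : ℤ) - x j) = (fun j => (y j : ℤ)) - fun j => (x j : ℤ) := rfl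
      rw [this, Matrix.mulVec_sub, hx.out, hy.out, sub_self])
    funext j
    have hj : (y j : ℤ) - x j = 0 := congrFun h0 j
    omega
  refine (hN.image fun n j => (n j : ℤ)).subset ?_
  rintro u ⟨hu, hb⟩
  have h : (fun j => ((u j).toNat : ℤ)) = u := funext fun j => Int.toNat_of_nonneg (hu j)
  exact ⟨fun j => (u j).toNat, by simpa only [Set.mem_ofPred_eq, h] using hb, h⟩

/-- The fiber `{u ∈ ℕ^d : A u = b}`, as a finite subset of `ℤ^d`. -/
def fiber {m d : ℕ} (A : Matrix (Fin m) (Fin d) ℤ) (hA : IsFiberDefining A) (b : Fin m → ℤ) :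
    Finset (Fin d → ℤ) :=
  (fiber_finite hA b).toFinset

/-- A finite set `M ⊆ ker_ℤ(A)` is a Markov basis for `A` if the fiber graph on the fiber of `b`
is connected for all `b ∈ ℕA`. -/
def IsMarkovBasis {m d : ℕ} (A : Matrix (Fin m) (Fin d) ℤ) (hA : IsFiberDefining A)
    (M : Finset (Fin d → ℤ)) : Prop :=
  (∀ x ∈ M, A.mulVec x = 0) ∧ ∀ b ∈ affineSemigroup A, (fiberGraph (fiber A hA b) M).Connected

/-! ## Dominated sequences and meaningful parametrizations -/

/-- The `ℚ`-relaxation `{x ∈ ℚ_{≥0}^d : A x = b}` of the fiber of `b`. -/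
def relaxedFiber {m d : ℕ} (A : Matrix (Fin m) (Fin d) ℤ) (b : Fin m → ℤ) : Set (Fin d → ℚ) :=
  {x | 0 ≤ x ∧ (A.map (Int.cast : ℤ → ℚ)).mulVec x = fun k => (b k : ℚ)}

/-- The sequence `b` is dominated (by `c`). -/
def IsDominated {m d : ℕ} (A : Matrix (Fin m) (Fin d) ℤ) (hA : IsFiberDefining A)
    (b : ℕ → Fin m → ℤ) : Prop :=
  ∃ c ∈ affineSemigroup A,
    0 < Module.finrank ℚ (affineSpan ℚ (relaxedFiber A c)).direction ∧
    (∀ i, b i - i • c ∈ affineSemigroup A) ∧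
    ∃ u ∈ fiber A hA c, ∃ w : ℕ → Fin d → ℤ, ∀ i,
      w i ∈ fiber A hA (b i - i • c) ∧ Function.support (w i) ⊆ Function.support u

/-- The sequence `b` has a meaningful parametrization. -/
def HasMeaningfulParametrization {m d : ℕ} (A : Matrix (Fin m) (Fin d) ℤ)
    (hA : IsFiberDefining A) (b : ℕ → Fin m → ℤ) : Prop :=
  ∃ q : Polynomial ℚ, ∀ i : ℕ, ((fiber A hA (b i)).card : ℚ) ≤ q.eval (i : ℚ)

end FiberWalk

end

open scoped Pointwise

namespace FiberWalk

/-! ## Spectral estimates for symmetric stochastic matrices -/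

section Spectral

variable {V : Type*} [Fintype V] [DecidableEq V] {S : Matrix V V ℝ}

/-! A fixed set of moves gives balls of polynomial size, so mixing is too slow. All nodes have
degree `|±M|`, so the transition matrix `S` is symmetric and stochastic. If `k` steps reach at most
`N` nodes, Cauchy–Schwarz bounds each diagonal entry of `S ^ (2k)` below by `1/N`, while its trace
is at most `1 + |V| λ ^ (2k)` (`card_le_of_support_le`). In a fiber graph, `N = (2Rk+1)^d` works.

If `λ ≤ 1 - 1/p(log |V|)`, then `k ≈ p(log |V|) log |V|` makes `λ ^ (2k) ≤ 1/|V|`, so `|V| ≤ 2N` is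
bounded by a polynomial in `log |V|`. This fails for large `|V|`, and dominated sequences have
unbounded fibers (`IsDominated.exists_le_card_fiber`). Expanders are the case of constant `p`. -/

theorem abs_eigenvalues_le_one (hS : S ∈ Matrix.rowStochastic ℝ V) (hH : S.IsHermitian) (i : V) :
    |hH.eigenvalues i| ≤ 1 := by
  have hmem : hH.eigenvalues i ∈ spectrum ℝ S := hH.eigenvalues_mem_spectrum_real i
  rw [← Matrix.spectrum_toLin', ← Module.End.hasEigenvalue_iff_mem_spectrum] at hmem
  -- Gershgorin: in a stochastic row, the disc around `S k k` has radius `1 - S k k`, so it lies in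
  -- `[-1, 1]`.
  obtain ⟨k, hk⟩ := eigenvalue_mem_ball hmem
  have h0 : ∀ j, ‖S k j‖ = S k j := fun j =>
    Real.norm_of_nonneg (Matrix.nonneg_of_mem_rowStochastic hS)
  simp only [h0] at hk
  have hsum := Matrix.sum_row_of_mem_rowStochastic hS k
  rw [← Finset.add_sum_erase _ _ (Finset.mem_univ k)] at hsum
  rw [Metric.mem_closedBall, Real.dist_eq, abs_le] at hk
  have := Matrix.nonneg_of_mem_rowStochastic hS (i := k) (j := k)
  rw [abs_le]
  constructor <;> linarith [hk.1, hk.2]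

theorem trace_pow_eq_sum_eigenvalues_pow (hH : S.IsHermitian) (k : ℕ) :
    (S ^ k).trace = ∑ i, hH.eigenvalues i ^ k := by
  conv_lhs => rw [hH.spectral_theorem, ← map_pow, Matrix.diagonal_pow,
    Unitary.conjStarAlgAut_apply, Matrix.trace_mul_comm, ← mul_assoc]
  simp [Matrix.trace_diagonal]

theorem map_norm_roots_charpoly (hH : S.IsHermitian) :
    ((S.map (algebraMap ℝ ℂ)).charpoly.roots.map fun z => ‖z‖) =
      Finset.univ.val.map fun i => |hH.eigenvalues i| := by
  rw [Matrix.charpoly_map, Polynomial.Splits.roots_map hH.splits_charpoly,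
    hH.roots_charpoly_eq_eigenvalues]
  simp [Multiset.map_map]

theorem getD_one_nonneg (l : List ℝ) (h0 : ∀ x ∈ l, 0 ≤ x) : 0 ≤ l.getD 1 0 := by
  rcases l with _ | ⟨a, _ | ⟨b, t⟩⟩
  · simp
  · simp
  · simpa using h0 b (by simp)

theorem slem_nonneg (S : Matrix V V ℝ) : 0 ≤ slem S := by
  refine getD_one_nonneg _ fun x hx => ?_
  rw [Multiset.mem_sort, Multiset.mem_map] at hx
  obtain ⟨z, -, rfl⟩ := hx
  exact norm_nonneg z

/-- The first entry contributes at most 1, and every later one is at most the second. Counting all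
`length` terms is harmless slack and covers lists with fewer than two entries. -/
theorem sum_pow_le_of_sorted (l : List ℝ) (hl : l.Pairwise (· ≥ ·)) (h0 : ∀ x ∈ l, 0 ≤ x)
    (h1 : ∀ x ∈ l, x ≤ 1) (k : ℕ) :
    (l.map fun x => x ^ k).sum ≤ 1 + l.length * l.getD 1 0 ^ k := by
  rcases l with _ | ⟨a, _ | ⟨b, t⟩⟩
  · simp
  · have : a ^ k ≤ 1 := pow_le_one₀ (h0 a (by simp)) (h1 a (by simp))
    have h2 : (0 : ℝ) ≤ (0 : ℝ) ^ k := by positivity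
    simp
    linarith
  · have ha : a ^ k ≤ 1 := pow_le_one₀ (h0 a (by simp)) (h1 a (by simp))
    have hb : 0 ≤ b := h0 b (by simp)
    have ht : ((b :: t).map fun x => x ^ k).sum ≤ ((b :: t).map fun _ => b ^ k).sum := by
      refine List.sum_le_sum fun x hx => pow_le_pow_left₀ (h0 x (by simp_all)) ?_ k
      rw [List.pairwise_cons, List.pairwise_cons] at hl
      rcases List.mem_cons.1 hx with rfl | hx
      · exact le_rfl
      · exact hl.2.1 x hx
    have hbk : 0 ≤ b ^ k := pow_nonneg hb k
    simp only [List.map_const', List.sum_replicate, nsmul_eq_mul, List.length_cons] at ht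
    simp only [List.map_cons, List.sum_cons, List.length_cons, List.getD_cons_succ,
      List.getD_cons_zero] at ht ⊢
    push_cast at ht ⊢
    nlinarith

theorem trace_pow_le_slem (hS : S ∈ Matrix.rowStochastic ℝ V) (hH : S.IsHermitian) (k : ℕ) :
    (S ^ (2 * k)).trace ≤ 1 + Fintype.card V * slem S ^ (2 * k) := by
  have hm := map_norm_roots_charpoly hH
  set s := (S.map (algebraMap ℝ ℂ)).charpoly.roots.map fun z => ‖z‖
  have hmem : ∀ x ∈ s.sort (· ≥ ·), ∃ i, |hH.eigenvalues i| = x := by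
    intro x hx
    rw [Multiset.mem_sort, hm] at hx
    simpa using hx
  have key := sum_pow_le_of_sorted (s.sort (· ≥ ·)) (Multiset.pairwise_sort _ _)
    (fun x hx => by obtain ⟨i, rfl⟩ := hmem x hx; exact abs_nonneg _)
    (fun x hx => by obtain ⟨i, rfl⟩ := hmem x hx; exact abs_eigenvalues_le_one hS hH i) (2 * k)
  have hsum : ((s.sort (· ≥ ·)).map fun x => x ^ (2 * k)).sum = (S ^ (2 * k)).trace := by
    rw [← Multiset.sum_coe, ← Multiset.map_coe, Multiset.sort_eq, hm, Multiset.map_map,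
      trace_pow_eq_sum_eigenvalues_pow hH]
    refine Finset.sum_congr rfl fun i _ => ?_
    -- The even exponent makes moduli and eigenvalues interchangeable.
    simp [pow_mul]
  have hcard : s.card = Fintype.card V := by rw [hm, Multiset.card_map]; rfl
  rwa [hsum, Multiset.length_sort, hcard] at key

/-- If from every point the walk reaches at most `N` points in `k` steps, then
`|V| ≤ N (1 + |V| λ ^ (2k))`: compare the trace of `S ^ (2k)` with its eigenvalues. -/
theorem card_le_of_support_le (hS : S ∈ Matrix.rowStochastic ℝ V) (hH : S.IsHermitian) (k N : ℕ)
    (hN : ∀ x, (Finset.univ.filter fun y => (S ^ k) x y ≠ 0).card ≤ N) :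
    (Fintype.card V : ℝ) ≤ N * (1 + Fintype.card V * slem S ^ (2 * k)) := by
  refine le_trans ?_ (mul_le_mul_of_nonneg_left (trace_pow_le_slem hS hH k) N.cast_nonneg)
  have hk := pow_mem hS k
  -- By symmetry the diagonal entry is the sum of squares of a row of `S ^ k`. That row sums to 1
  -- over a support of at most `N` points, so Cauchy–Schwarz applies.
  have hdiag : ∀ x, (1 : ℝ) ≤ N * (S ^ (2 * k)) x x := by
    intro x
    have hsq : (S ^ (2 * k)) x x = ∑ y, (S ^ k) x y ^ 2 := by
      rw [two_mul, pow_add, Matrix.mul_apply]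
      refine Finset.sum_congr rfl fun y _ => ?_
      have : (S ^ k) y x = (S ^ k) x y := by
        simpa using ((hH.pow k).apply x y)
      rw [this, sq]
    have h1 : ∑ y with (S ^ k) x y ≠ 0, (S ^ k) x y = 1 := by
      rw [Finset.sum_filter_ne_zero]
      exact Matrix.sum_row_of_mem_rowStochastic hk x
    have h2 := sq_sum_le_card_mul_sum_sq (s := Finset.univ.filter fun y => (S ^ k) x y ≠ 0)
      (f := fun y => (S ^ k) x y)
    rw [h1, one_pow] at h2
    rw [hsq]
    refine h2.trans (mul_le_mul (by exact_mod_cast hN x) ?_ (by positivity) (by positivity))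
    exact Finset.sum_le_univ_sum_of_nonneg fun y => sq_nonneg _
  calc (Fintype.card V : ℝ) = ∑ _x : V, (1 : ℝ) := by simp
    _ ≤ ∑ x, N * (S ^ (2 * k)) x x := Finset.sum_le_sum fun x _ => hdiag x
    _ = N * (S ^ (2 * k)).trace := by rw [← Finset.mul_sum]; rfl

end Spectral

/-! ## The simple walk on a fiber graph -/

section Walk

variable {d : ℕ} (F M : Finset (Fin d → ℤ))

/-- Each `m ∈ ±M` contributes exactly one edge at `u`: to `u + m` if that lies in `F`, otherwise a
loop. This regularity is what makes the walk matrix symmetric. -/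
theorem fiberGraph_degree (u : F) : (fiberGraph F M).degree u = (M ∪ -M).card := by
  have hmem : ∀ x : Fin d → ℤ, -x ∈ M ∪ -M ↔ x ∈ M ∪ -M := fun x => by
    simp only [Finset.mem_union, Finset.mem_neg', neg_neg]
    exact or_comm
  have h1 : (Finset.univ.filter fun v : F => (u : Fin d → ℤ) - v ∈ M ∪ -M).card =
      ((M ∪ -M).filter fun m => (u : Fin d → ℤ) + m ∈ F).card := by
    refine Finset.card_bij (fun v _ => (v : Fin d → ℤ) - u) ?_ ?_ ?_
    · intro v hv
      rw [Finset.mem_filter] at hv ⊢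
      refine ⟨(hmem _).1 (by simpa using hv.2), by simp⟩
    · intro v _ w _ h
      exact Subtype.ext (sub_left_injective h)
    · intro m hm
      rw [Finset.mem_filter] at hm
      refine ⟨⟨_, hm.2⟩, ?_, by simp⟩
      rw [Finset.mem_filter]
      refine ⟨Finset.mem_univ _, ?_⟩
      simpa [-Finset.mem_union] using (hmem m).2 hm.1
  simp only [Multigraph.degree, fiberGraph, Finset.sum_add_distrib, Finset.sum_ite_eq,
    Finset.mem_univ, if_true, Finset.sum_boole]
  rw [Nat.cast_id, h1, Finset.card_filter_add_card_filter_not]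

theorem walkMatrix_mem_rowStochastic (h : (M ∪ -M).Nonempty) :
    (fiberGraph F M).walkMatrix ∈ Matrix.rowStochastic ℝ F := by
  rw [Matrix.mem_rowStochastic_iff_sum]
  refine ⟨fun u v => by simp only [Multigraph.walkMatrix, Matrix.of_apply]; positivity, fun u => ?_⟩
  have hd : ((fiberGraph F M).degree u : ℝ) ≠ 0 := by
    rw [fiberGraph_degree]
    exact_mod_cast h.card_pos.ne'
  simp only [Multigraph.walkMatrix, Matrix.of_apply]
  rw [← Finset.sum_div, div_eq_one_iff_eq hd, Multigraph.degree]
  push_cast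
  rfl

theorem walkMatrix_isHermitian : (fiberGraph F M).walkMatrix.IsHermitian := by
  ext u v
  simp only [Multigraph.walkMatrix, Matrix.conjTranspose_apply, Matrix.of_apply, star_trivial,
    fiberGraph_degree, (fiberGraph F M).symm v u]

variable {F M}

theorem abs_sub_le_of_walkMatrix_ne_zero {R : ℕ} (hR : ∀ x ∈ M, ∀ j, |x j| ≤ R) {u v : F}
    (h : (fiberGraph F M).walkMatrix u v ≠ 0) (j : Fin d) :
    |(u : Fin d → ℤ) j - (v : Fin d → ℤ) j| ≤ R := by
  by_cases huv : u = v
  · subst huv; simp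
  have hmem : (u : Fin d → ℤ) - v ∈ M ∪ -M := by
    by_contra hn
    exact h (by simp [Multigraph.walkMatrix, fiberGraph, -Finset.mem_union, hn, huv])
  rw [Finset.mem_union, Finset.mem_neg'] at hmem
  rcases hmem with hm | hm
  · simpa using hR _ hm j
  · simpa [abs_sub_comm] using hR _ hm j

theorem abs_sub_le_of_walkMatrix_pow_ne_zero {R : ℕ} (hR : ∀ x ∈ M, ∀ j, |x j| ≤ R) (k : ℕ)
    {u v : F} (h : ((fiberGraph F M).walkMatrix ^ k) u v ≠ 0) (j : Fin d) :
    |(u : Fin d → ℤ) j - (v : Fin d → ℤ) j| ≤ R * k := by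
  induction k generalizing v with
  | zero =>
    have : u = v := by
      by_contra hn
      exact h (by simp [hn])
    simp [this]
  | succ k ih =>
    rw [pow_succ, Matrix.mul_apply] at h
    obtain ⟨w, -, hw⟩ := Finset.exists_ne_zero_of_sum_ne_zero h
    have h1 := ih (left_ne_zero_of_mul hw)
    have h2 := abs_sub_le_of_walkMatrix_ne_zero hR (right_ne_zero_of_mul hw) j
    have h3 := abs_sub_le ((u : Fin d → ℤ) j) ((w : Fin d → ℤ) j) ((v : Fin d → ℤ) j)
    push_cast
    linarith

/-- Each step changes a coordinate by at most `R`, so the reachable points lie in a box of side `2Rk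
+ 1`. -/
theorem card_support_walkMatrix_pow_le {R : ℕ} (hR : ∀ x ∈ M, ∀ j, |x j| ≤ R) (k : ℕ) (u : F) :
    (Finset.univ.filter fun v => ((fiberGraph F M).walkMatrix ^ k) u v ≠ 0).card ≤
      (2 * R * k + 1) ^ d := by
  have h := Finset.card_le_card_of_injOn (s := Finset.univ.filter fun v =>
      ((fiberGraph F M).walkMatrix ^ k) u v ≠ 0)
    (t := Fintype.piFinset fun j => Finset.Icc ((u : Fin d → ℤ) j - R * k)
      ((u : Fin d → ℤ) j + R * k)) (fun v => (v : Fin d → ℤ))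
    (fun v hv => by
      have hv : ((fiberGraph F M).walkMatrix ^ k) u v ≠ 0 := by simpa using hv
      simp only [Finset.mem_coe, Fintype.mem_piFinset, Finset.mem_Icc]
      intro j
      have := abs_le.1 (abs_sub_le_of_walkMatrix_pow_ne_zero hR k hv j)
      constructor <;> linarith [this.1, this.2])
    (fun v _ w _ h => Subtype.ext h)
  refine h.trans (le_of_eq ?_)
  rw [Fintype.card_piFinset]
  simp only [Int.card_Icc]
  have : ∀ j, ((u : Fin d → ℤ) j + R * k + 1 - ((u : Fin d → ℤ) j - R * k)).toNat =
      2 * R * k + 1 := fun j => by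
    have : (u : Fin d → ℤ) j + R * k + 1 - ((u : Fin d → ℤ) j - R * k) =
      ((2 * R * k + 1 : ℕ) : ℤ) := by push_cast; ring
    rw [this, Int.toNat_natCast]
  simp [this]

theorem exists_abs_le (M : Finset (Fin d → ℤ)) : ∃ R : ℕ, ∀ x ∈ M, ∀ j, |x j| ≤ R := by
  refine ⟨∑ x ∈ M, ∑ j, (x j).natAbs, fun x hx j => ?_⟩
  rw [Int.abs_eq_natAbs]
  refine Int.ofNat_le.2 ?_
  exact (Finset.single_le_sum (f := fun j => (x j).natAbs) (fun _ _ => Nat.zero_le _)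
    (Finset.mem_univ j)).trans (Finset.single_le_sum (f := fun x => ∑ j, (x j).natAbs)
    (fun _ _ => Nat.zero_le _) hx)

/-- Without moves all degrees vanish and the walk matrix is not stochastic. -/
theorem union_neg_nonempty_of_connected (h : (fiberGraph F M).Connected) (hF : 1 < F.card) :
    (M ∪ -M).Nonempty := by
  obtain ⟨u, hu, v, hv, hne⟩ := Finset.one_lt_card.1 hF
  rcases Relation.ReflTransGen.cases_head (h.2 ⟨u, hu⟩ ⟨v, hv⟩) with h | ⟨w, hw, -⟩
  · exact absurd (congrArg Subtype.val h) hne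
  · by_contra hn
    rw [Finset.not_nonempty_iff_eq_empty] at hn
    simp [fiberGraph, hn] at hw

end Walk

/-- Fiber graphs of a fixed set of moves on arbitrarily large node sets do not mix rapidly, since
the balls in such a graph grow polynomially. -/
theorem not_isRapidlyMixing_of_card_unbounded {d : ℕ} (M : Finset (Fin d → ℤ))
    (F : ℕ → Finset (Fin d → ℤ)) (hM : (M ∪ -M).Nonempty)
    (hF : ∀ n, ∃ i, n ≤ (F i).card) : ¬ IsRapidlyMixing fun i => fiberGraph (F i) M := by
  rintro ⟨p, hp, h⟩
  obtain ⟨R, hR⟩ := exists_abs_le M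
  set P : Polynomial ℝ := p.map (algebraMap ℚ ℝ) with hP
  -- With `k ≤ p(L) L + 2`, this dominates the ball size `(2Rk+1)^d` as a polynomial in `L = log n`.
  set Q : Polynomial ℝ := (Polynomial.C (2 * R : ℝ) * (P * Polynomial.X + 2) + 1) ^ d with hQ
  have hlim := (Polynomial.tendsto_div_exp_atTop Q).comp
    (Real.tendsto_log_atTop.comp tendsto_natCast_atTop_atTop)
  obtain ⟨n₀, hn₀⟩ := Filter.eventually_atTop.1
    (hlim.eventually (gt_mem_nhds (show (0 : ℝ) < 1 / 2 by norm_num)))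
  obtain ⟨i, hi⟩ := hF (n₀ + 1)
  obtain ⟨hpos, hle⟩ := h i
  have hq := hn₀ (F i).card (by omega)
  rw [Fintype.card_coe] at hpos hle
  set n := (F i).card with hn
  have hn1 : (1 : ℝ) ≤ n := by exact_mod_cast (show 1 ≤ n by omega)
  have hL : 0 ≤ Real.log n := Real.log_nonneg hn1
  set L := Real.log n with hLdef
  have hPL : Polynomial.aeval L p = P.eval L := by
    rw [hP, Polynomial.eval_map_algebraMap]
  rw [hPL] at hpos hle
  set c := P.eval L with hc
  -- The least natural number exceeding `c L`; then `(1 - 1/c) ^ (2k) ≤ exp (-2k/c) ≤ 1/n`.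
  set k := ⌊c * L⌋₊ + 1 with hk
  have hk1 : c * L < k := by rw [hk]; exact_mod_cast Nat.lt_floor_add_one _
  have hk2 : (k : ℝ) ≤ c * L + 2 := by
    have := Nat.floor_le (mul_nonneg hpos.le hL)
    rw [hk]; push_cast; linarith
  have key := card_le_of_support_le (walkMatrix_mem_rowStochastic (F i) M hM)
    (walkMatrix_isHermitian (F i) M) k _ (card_support_walkMatrix_pow_le hR k)
  rw [Fintype.card_coe, ← hn] at key
  set s := slem (fiberGraph (F i) M).walkMatrix with hs
  have hs0 : 0 ≤ s := slem_nonneg _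
  have hsk : s ^ (2 * k) ≤ 1 / n := by
    have h1 : s ≤ Real.exp (-(1 / c)) := hle.trans (by linarith [Real.add_one_le_exp (-(1 / c))])
    have hkL : L ≤ k / c := by rw [le_div_iff₀ hpos]; linarith
    calc s ^ (2 * k) ≤ Real.exp (-(1 / c)) ^ (2 * k) := pow_le_pow_left₀ hs0 h1 _
      _ = Real.exp (-(2 * (k / c))) := by
        rw [← Real.exp_nat_mul]; push_cast; ring_nf
      _ ≤ Real.exp (-L) := Real.exp_le_exp.2 (by linarith)
      _ = 1 / n := by rw [Real.exp_neg, hLdef, Real.exp_log (by linarith), one_div]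
  have hball : (((2 * R * k + 1) ^ d : ℕ) : ℝ) ≤ Q.eval L := by
    have : Q.eval L = (2 * R * (c * L + 2) + 1) ^ d := by simp [hQ, hc]
    rw [this]
    push_cast
    gcongr
  have hq' : Q.eval L < n / 2 := by
    simp only [Function.comp_apply, ← hLdef] at hq
    rw [hLdef, Real.exp_log (by linarith), ← hLdef, div_lt_iff₀ (by linarith)] at hq
    linarith
  have h2 : 1 + (n : ℝ) * s ^ (2 * k) ≤ 2 := by
    have := mul_le_mul_of_nonneg_left hsk (show (0 : ℝ) ≤ n by linarith)
    rw [mul_one_div_cancel (by linarith)] at this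
    linarith
  have h3 := mul_le_mul_of_nonneg_left h2
    (show (0 : ℝ) ≤ (((2 * R * k + 1) ^ d : ℕ) : ℝ) by positivity)
  -- Contradiction: `n ≤ 2 (2Rk+1)^d ≤ 2 Q(L) < n`.
  linarith

theorem IsExpander.isRapidlyMixing {V : ℕ → Type*} [∀ i, Fintype (V i)] [∀ i, DecidableEq (V i)]
    {G : ∀ i, Multigraph (V i)} (h : IsExpander G) : IsRapidlyMixing G := by
  obtain ⟨ε, hε, h⟩ := h
  obtain ⟨q, hq⟩ := exists_nat_gt (1 / ε)
  have hq0 : (0 : ℝ) < q := lt_trans (by positivity) hq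
  refine ⟨Polynomial.C (q : ℚ), fun k => ?_, fun i => ?_⟩
  · rw [Polynomial.coeff_C]; split_ifs <;> positivity
  · have : Polynomial.aeval (Real.log (Fintype.card (V i))) (Polynomial.C (q : ℚ)) = (q : ℝ) := by
      simp
    rw [this]
    refine ⟨hq0, (h i).trans ?_⟩
    have := (one_div_lt hε hq0).1 hq
    linarith

/-! ## Fibers of dominated sequences -/

section Dominated

variable {m d : ℕ} {A : Matrix (Fin m) (Fin d) ℤ} {hA : IsFiberDefining A}

theorem mem_fiber {b : Fin m → ℤ} {x : Fin d → ℤ} :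
    x ∈ fiber A hA b ↔ 0 ≤ x ∧ A.mulVec x = b := by
  simp [fiber]

theorem exists_common_denominator (x : Fin d → ℚ) :
    ∃ k : ℕ, 0 < k ∧ ∃ y : Fin d → ℤ, ∀ j, (y j : ℚ) = k * x j := by
  refine ⟨∏ j, (x j).den, Finset.prod_pos fun j _ => (x j).den_pos,
    fun j => (∏ l ∈ Finset.univ.erase j, ((x l).den : ℤ)) * (x j).num, fun j => ?_⟩
  rw [← Finset.mul_prod_erase _ _ (Finset.mem_univ j)]
  have := Rat.mul_den_eq_num (x j)
  push_cast
  rw [← this]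
  ring

theorem mem_fiber_of_mem_relaxedFiber {c : Fin m → ℤ} {x : Fin d → ℚ} (hx : x ∈ relaxedFiber A c)
    {k : ℕ} {y : Fin d → ℤ} (hy : ∀ j, (y j : ℚ) = k * x j) : y ∈ fiber A hA (k • c) := by
  rw [mem_fiber]
  refine ⟨fun j => ?_, ?_⟩
  · have : (0 : ℚ) ≤ y j := by
      rw [hy]; exact mul_nonneg k.cast_nonneg (hx.1 j)
    exact_mod_cast this
  · funext r
    have h := congrFun hx.2 r
    simp only [Matrix.mulVec, dotProduct, Matrix.map_apply] at h ⊢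
    have : ((∑ j, A r j * y j : ℤ) : ℚ) = ((k • c) r : ℤ) := by
      simp only [Pi.smul_apply, nsmul_eq_mul]
      push_cast
      rw [← h, Finset.mul_sum]
      exact Finset.sum_congr rfl fun j _ => by rw [hy]; ring
    exact_mod_cast this

/-- Positive dimension yields two distinct rational points; multiplying by a common denominator
keeps them distinct. -/
theorem exists_ne_mem_fiber_nsmul {c : Fin m → ℤ}
    (h : 0 < Module.finrank ℚ (affineSpan ℚ (relaxedFiber A c)).direction) :
    ∃ k : ℕ, ∃ u ∈ fiber A hA (k • c), ∃ v ∈ fiber A hA (k • c), u ≠ v := by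
  have hnt : (relaxedFiber A c).Nontrivial := by
    by_contra hn
    rw [Set.not_nontrivial_iff] at hn
    rw [direction_affineSpan, vectorSpan_of_subsingleton ℚ hn, finrank_bot] at h
    exact lt_irrefl _ h
  obtain ⟨x, hx, y, hy, hxy⟩ := hnt
  obtain ⟨k, hk, x', hx'⟩ := exists_common_denominator x
  obtain ⟨l, hl, y', hy'⟩ := exists_common_denominator y
  refine ⟨l * k, _, mem_fiber_of_mem_relaxedFiber (y := fun j => l * x' j) hx fun j => ?_, _,
    mem_fiber_of_mem_relaxedFiber (y := fun j => k * y' j) hy fun j => ?_, fun he => hxy ?_⟩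
  · push_cast; rw [hx']; ring
  · push_cast; rw [hy']; ring
  · funext j
    have hj : ((l * x' j : ℤ) : ℚ) = (k * y' j : ℤ) := by exact_mod_cast congrFun he j
    push_cast at hj
    rw [hx', hy'] at hj
    have hlk : (l : ℚ) * k ≠ 0 := by positivity
    exact mul_left_cancel₀ hlk (by linarith)

/-- The fibers of a dominated sequence are arbitrarily large. -/
theorem IsDominated.exists_le_card_fiber {b : ℕ → Fin m → ℤ} (h : IsDominated A hA b) (n : ℕ) :
    ∃ i, n ≤ (fiber A hA (b i)).card := by
  obtain ⟨c, -, hdim, -, _, -, w, hw⟩ := h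
  obtain ⟨k, u, hu, v, hv, huv⟩ := exists_ne_mem_fiber_nsmul (hA := hA) hdim
  -- At this index the fiber contains the `n` points `w + s u + (n - s) v`, `s < n`, distinct
  -- because `u ≠ v`.
  refine ⟨n * k, ?_⟩
  have hwn := mem_fiber.1 (hw (n * k)).1
  rw [mem_fiber] at hu hv
  refine (Finset.card_range n).symm.le.trans ?_
  refine Finset.card_le_card_of_injOn
    (fun s => w (n * k) + (s • u + (n - s) • v)) (fun s hs => ?_) fun s hs t ht hst => ?_
  · have hs : s < n := by simpa using hs
    refine mem_fiber.2 ⟨add_nonneg hwn.1 (add_nonneg (nsmul_nonneg hu.1 _)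
      (nsmul_nonneg hv.1 _)), ?_⟩
    rw [Matrix.mulVec_add, Matrix.mulVec_add, Matrix.mulVec_smul, Matrix.mulVec_smul, hwn.2, hu.2,
      hv.2, ← add_nsmul, Nat.add_sub_of_le hs.le, mul_nsmul', sub_add_cancel]
  · have hs : s < n := by simpa using hs
    have ht : t < n := by simpa using ht
    obtain ⟨j, hj⟩ := Function.ne_iff.1 huv
    have h := congrFun hst j
    simp only [Pi.add_apply, Pi.smul_apply] at h
    simp only [nsmul_eq_mul, Nat.cast_sub hs.le, Nat.cast_sub ht.le] at h
    have h0 : ((s : ℤ) - t) * (u j - v j) = 0 := by linarith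
    rcases mul_eq_zero.1 h0 with h0 | h0
    · exact_mod_cast sub_eq_zero.1 h0
    · exact absurd (sub_eq_zero.1 h0) hj

end Dominated

end FiberWalk

theorem theorem1p1 {m d : ℕ} (A : Matrix (Fin m) (Fin d) ℤ) (hA : FiberWalk.IsFiberDefining A)
    (M : Finset (Fin d → ℤ)) (hM : FiberWalk.IsMarkovBasis A hA M)
    (b : ℕ → Fin m → ℤ) (hb : ∀ i, b i ∈ FiberWalk.affineSemigroup A)
    (hdom : FiberWalk.IsDominated A hA b) :
    (¬ FiberWalk.IsExpander fun i =>
        FiberWalk.fiberGraph (FiberWalk.fiber A hA (b i)) M) ∧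
      (FiberWalk.HasMeaningfulParametrization A hA b →
        ¬ FiberWalk.IsRapidlyMixing fun i =>
          FiberWalk.fiberGraph (FiberWalk.fiber A hA (b i)) M) := by
  have hcard := hdom.exists_le_card_fiber
  obtain ⟨i, hi⟩ := hcard 2
  have hne := FiberWalk.union_neg_nonempty_of_connected (hM.2 _ (hb i)) hi
  have hmix := FiberWalk.not_isRapidlyMixing_of_card_unbounded M _ hne hcard
  exact ⟨fun h => hmix h.isRapidlyMixing, fun _ => hmix⟩
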